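/- Let $R$ be a ring, not necessarily associative, commutative or unital, and write $(x,y,z)=(xy)z-x(yz)$. Suppose that $R$ is alternative, i.e. $(x,x,y)=0=(y,x,x)$ for all $x,y\in R$, and $3$-torsion free, i.e. $3x=0$ implies $x=0$ for $x\in R$. Call $R$ prime if $AB\neq 0$ for any two nonzero two-sided ideals $A,B$ of $R$. Then the following are equivalent: (i) $R$ is prime; (ii) for all $a,b\in R$, if $(ax)b=0$ for every $x\in R$, then $a=0$ or $b=0$; (iii) for all $a,b\in R$, if $a(xb)=0$ for every $x\in R$, then $a=0$ or $b=0$. -/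

import Mathlib

/-- A not necessarily associative ring `R` (a unit is not required) is alternative if
`(x, x, y) = 0 = (y, x, x)` for all `x, y`, where `(x, y, z) = (xy)z - x(yz)`. -/
structure IsAlternativeRing (R : Type*) [NonUnitalNonAssocRing R] : Prop where
  left_alternative : ∀ x y : R, associator x x y = 0
  right_alternative : ∀ x y : R, associator y x x = 0

/-- `R` is `k`-torsion free if `k x = 0` implies `x = 0`. -/
def IsTorsionFreeBy (k : ℕ) (R : Type*) [NonUnitalNonAssocRing R] : Prop :=
  ∀ x : R, k • x = 0 → x = 0

/-- `R` is prime if `A B ≠ 0` for any two nonzero (two-sided) ideals `A`, `B` of `R`, that is,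
some product `a b` with `a ∈ A` and `b ∈ B` is nonzero. -/
def IsPrimeNonAssocRing (R : Type*) [NonUnitalNonAssocRing R] : Prop :=
  ∀ A B : TwoSidedIdeal R, A ≠ ⊥ → B ≠ ⊥ → ∃ a ∈ A, ∃ b ∈ B, a * b ≠ 0

/-!
Skew symmetry of the associator and of the Kleinfeld function gives the Moufang identities, and the
fact that for `ac = ca = 0` the map `x ↦ (a, x, c)` is a derivation which `a` annihilates from both
sides (`isLeibniz_associator`, `annihilates_associator`). The hard implications, from primeness to
the elementwise conditions, rest on such derivations, in three steps.

*Strong annihilation.* If `v` annihilates the range of a derivation `d` from both sides and moreover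
`(v, R, dR) = 0`, then the associators `(vs, t, dx)` satisfy `(vs, t, dx) = -2 (vt, x, ds)`. Three
applications give `9 (vs, t, dx) = 0`, so that `vs`, and likewise `sv`, inherits the property from
`v`. Hence such `v` form an ideal, each element of which annihilates the range of `d`, and in a
prime ring `v = 0` or `d = 0` (`eq_zero_of_stronglyAnnihilates`).

*Orthogonality.* Call `a` and `b` orthogonal if all products in which each of them occurs once,
together with at most one further element, vanish. The identity `associator_relation` for the pair
`a`, `zb` shows that `G x y = (a, x, (b, y, za))` satisfies `2 G x y = G y x`, hence `3 G = 0`, and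
`a` strongly annihilates `y ↦ (b, y, za)`. For nonzero `a` and `b` both derivations `(b, ·, za)` and
`(a, ·, zb)` are therefore zero, which makes `zb` and `bz` orthogonal to `a`. So the elements
orthogonal to `a ≠ 0` form an ideal annihilated by `a`, and this ideal is zero
(`Orthogonal.eq_zero_or_eq_zero`).

*The condition `(aR)b = 0`.* An element `c` with `(cR)c = 0` has a square with the same property and
with square zero, so it is zero by two uses of orthogonality (`eq_zero_of_mul_mul_self`). By the
Moufang identities, `(aR)b = 0` implies that `t = (by)a`, `t = ab` and `t = ba` satisfy
`(tR)t = 0`, so they vanish. Now `associator_relation` for the pair `a`, `b` gives the relation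
`2 P x y = P y x` for `P x y = (a, x, (a, y, b))`, so `a = 0` or `(a, ·, b) = 0`, and in the latter
case `a` and `b` are orthogonal (`eq_zero_or_eq_zero_of_mul_mul`).

The condition `a(Rb) = 0` is the previous one in the opposite ring.
-/

/-- `d` satisfies the Leibniz rule. -/
def IsLeibniz {R : Type*} [NonUnitalNonAssocRing R] (d : R → R) : Prop :=
  ∀ x y, d (x * y) = d x * y + x * d y

/-- `v` annihilates the range of `d` from both sides. -/
structure Annihilates {R : Type*} [NonUnitalNonAssocRing R] (v : R) (d : R → R) : Prop where
  mul_apply : ∀ x, v * d x = 0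
  apply_mul : ∀ x, d x * v = 0

/-- `v` annihilates the range of `d` from both sides and associates with it. For a derivation `d`
of an alternative ring this says that `v`, all `v * y` and all `y * v` annihilate the range of `d`,
see `IsAlternativeRing.annihilates_mul_right` and `IsAlternativeRing.annihilates_mul_left`. -/
structure StronglyAnnihilates {R : Type*} [NonUnitalNonAssocRing R] (v : R) (d : R → R) : Prop
    extends Annihilates v d where
  associator_apply : ∀ y x, associator v y (d x) = 0

namespace IsAlternativeRing

variable {R : Type*} [NonUnitalNonAssocRing R]

/-! ### Alternative identities and the Kleinfeld function -/

theorem swap_left (h : IsAlternativeRing R) (x y z : R) :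
    associator x y z = -associator y x z := by
  have e := h.left_alternative (x + y) z
  have e1 := h.left_alternative x z
  have e2 := h.left_alternative y z
  simp only [associator, mul_add, add_mul] at e e1 e2 ⊢
  linear_combination (norm := abel) e - e1 - e2

theorem swap_right (h : IsAlternativeRing R) (x y z : R) :
    associator x y z = -associator x z y := by
  have e := h.right_alternative (y + z) x
  have e1 := h.right_alternative y x
  have e2 := h.right_alternative z x
  simp only [associator, mul_add, add_mul] at e e1 e2 ⊢
  linear_combination (norm := abel) e - e1 - e2

theorem rotate (h : IsAlternativeRing R) (x y z : R) :
    associator x y z = associator y z x := by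
  rw [h.swap_left, h.swap_right, neg_neg]

theorem flexible (h : IsAlternativeRing R) (x y : R) : associator x y x = 0 := by
  rw [h.rotate, h.right_alternative]

theorem flexible_mul (h : IsAlternativeRing R) (x y : R) : x * y * x = x * (y * x) :=
  sub_eq_zero.1 (h.flexible x y)

theorem mul_self_mul (h : IsAlternativeRing R) (x y : R) : x * x * y = x * (x * y) :=
  sub_eq_zero.1 (h.left_alternative x y)

theorem mul_mul_self (h : IsAlternativeRing R) (x y : R) : y * x * x = y * (x * x) :=
  sub_eq_zero.1 (h.right_alternative x y)

/-- The Kleinfeld function `(wx, y, z) - x(w, y, z) - (x, y, z)w`. In an alternative ring it is a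
skew-symmetric function of its four arguments. -/
def kleinfeld (w x y z : R) : R :=
  associator (w * x) y z - x * associator w y z - associator x y z * w

theorem kleinfeld_swap_right (h : IsAlternativeRing R) (w x y z : R) :
    kleinfeld w x y z = -kleinfeld w x z y := by
  simp only [kleinfeld, h.swap_right _ y z, mul_neg, neg_mul]
  abel

theorem kleinfeld_rotate (h : IsAlternativeRing R) (w x y z : R) :
    kleinfeld w x y z = -kleinfeld z w x y := by
  have e₁ := h.rotate w (x * y) z
  have e₂ := h.rotate w x (y * z)
  have e₃ := h.rotate x (y * z) w
  have e₄ := h.rotate x y (z * w)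
  have e₅ := h.rotate y (z * w) x
  have e₆ := congrArg (x * ·) (h.rotate w y z)
  have e₇ := congrArg (w * ·) (h.rotate z x y)
  simp only [kleinfeld] at *
  linear_combination (norm := abel) -associator_cocycle w x y z - associator_cocycle x y z w
    + e₁ - e₂ - e₄ - e₅ - e₆ - e₇

theorem kleinfeld_self_right (h : IsAlternativeRing R) (w x y : R) : kleinfeld w x y y = 0 := by
  simp [kleinfeld, h.right_alternative]

theorem kleinfeld_swap_pairs (h : IsAlternativeRing R) (w x y z : R) :
    kleinfeld w x y z = kleinfeld y z w x := by
  rw [h.kleinfeld_rotate, h.kleinfeld_rotate z, neg_neg]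

theorem kleinfeld_swap_left (h : IsAlternativeRing R) (w x y z : R) :
    kleinfeld w x y z = -kleinfeld x w y z := by
  rw [h.kleinfeld_swap_pairs, h.kleinfeld_swap_right, h.kleinfeld_swap_pairs y]

/-- The Kleinfeld function in terms of commutators. It is obtained by subtracting the expression
of `3 • kleinfeld` that comes from the cocycle identity from that of `4 • kleinfeld` given by skew
symmetry, so that no division is needed. -/
theorem kleinfeld_eq (h : IsAlternativeRing R) (w x y z : R) :
    kleinfeld w x y z =
      associator (w * x - x * w) y z + associator (y * z - z * y) w x := by
  have e₁ := h.swap_left w (x * y) z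
  have e₂ := h.swap_right (x * y) w z
  have e₃ := h.rotate w x (y * z)
  have e₄ := h.rotate x (y * z) w
  have k₁ := h.kleinfeld_swap_left w x y z
  have k₂ := h.kleinfeld_swap_left y z w x
  have k₃ := h.kleinfeld_swap_pairs w x y z
  have k₄ := h.kleinfeld_rotate x y z w
  have c := associator_cocycle w x y z
  simp only [kleinfeld, h.rotate y w x, h.rotate z w x, h.rotate x z w, ← h.rotate w y z]
    at k₁ k₂ k₃ k₄ ⊢
  have s₁ : associator (w * x - x * w) y z = associator (w * x) y z - associator (x * w) y z := by
    simp only [associator, sub_mul]; abel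
  have s₂ : associator (y * z - z * y) w x = associator (y * z) w x - associator (z * y) w x := by
    simp only [associator, sub_mul]; abel
  rw [s₁, s₂]
  linear_combination (norm := abel) k₁ + k₂ + k₃ - k₄ + c - e₁ + e₂ + e₃ + e₄

/-! ### Moufang identities -/

theorem associator_mul_right (h : IsAlternativeRing R) (x y z : R) :
    associator x z (z * y) = associator x z y * z := by
  have k : kleinfeld z y x z = 0 := by
    rw [h.kleinfeld_rotate, h.kleinfeld_rotate, h.kleinfeld_rotate, h.kleinfeld_self_right]
    simp
  simp only [kleinfeld, h.flexible, mul_zero, sub_zero] at k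
  rw [h.rotate, h.rotate, h.rotate x, h.rotate z, sub_eq_zero.1 k]

theorem associator_mul_left (h : IsAlternativeRing R) (x y z : R) :
    associator x z (y * z) = z * associator x z y := by
  have k : kleinfeld y z x z = 0 := by
    rw [h.kleinfeld_swap_right, h.kleinfeld_rotate, h.kleinfeld_self_right]
    simp
  simp only [kleinfeld, h.flexible, zero_mul, sub_zero] at k
  rw [h.rotate, h.rotate, h.rotate x, h.rotate z, sub_eq_zero.1 k]

theorem middle_moufang (h : IsAlternativeRing R) (x y z : R) :
    x * y * (z * x) = x * (y * z) * x := by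
  have e₁ := h.associator_mul_left y z x
  have e₂ := h.swap_left x y (z * x)
  have e₃ := congrArg (x * ·) (h.rotate x y z)
  have e₄ := congrArg (x * ·) (h.swap_left y x z)
  have e₅ := h.flexible x (y * z)
  simp only [associator, mul_sub, mul_neg] at *
  linear_combination (norm := abel) e₂ - e₁ - e₄ + e₃ - e₅

theorem left_moufang (h : IsAlternativeRing R) (x y z : R) :
    x * (y * x) * z = x * (y * (x * z)) := by
  have e₁ := h.associator_mul_left z y x
  have e₂ := h.rotate z x (y * x)
  have e₃ := congrArg (x * ·) (h.rotate z x y)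
  have e₄ := congrArg (x * ·) (h.swap_left y x z)
  simp only [associator, mul_sub, mul_neg] at *
  linear_combination (norm := abel) e₁ - e₂ + e₃ + e₄

theorem middle_moufang_add (h : IsAlternativeRing R) (x y z w : R) :
    x * y * (z * w) + w * y * (z * x) = x * (y * z) * w + w * (y * z) * x := by
  have e := h.middle_moufang (x + w) y z
  have e₁ := h.middle_moufang x y z
  have e₂ := h.middle_moufang w y z
  simp only [mul_add, add_mul] at e
  linear_combination (norm := abel) e - e₁ - e₂

theorem middle_moufang_add' (h : IsAlternativeRing R) (x y z w : R) :
    x * y * (z * w) + w * y * (z * x) = x * (y * z * w) + w * (y * z * x) := by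
  have e := h.middle_moufang (x + w) y z
  have e₁ := h.middle_moufang x y z
  have e₂ := h.middle_moufang w y z
  rw [h.flexible_mul] at e e₁ e₂
  simp only [mul_add, add_mul] at e
  linear_combination (norm := abel) e - e₁ - e₂

/-! ### Derivations and strong annihilation -/

section Leibniz

variable {d : R → R} {v : R}

theorem mul_apply_mul (h : IsAlternativeRing R) (hv : Annihilates v d) (x y : R) :
    v * (d x * y) = associator v y (d x) := by
  have e := h.swap_right v y (d x)
  rw [associator_apply v (d x), hv.mul_apply] at e
  rw [e]; simp

theorem mul_apply_mul' (h : IsAlternativeRing R) (hv : Annihilates v d) (x y : R) :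
    y * d x * v = associator v y (d x) := by
  rw [h.rotate v, associator_apply, hv.apply_mul]; simp

theorem mul_mul_apply' (h : IsAlternativeRing R) (hv : Annihilates v d) (x y : R) :
    y * v * d x = -associator v y (d x) := by
  rw [h.swap_left v, associator_apply, hv.mul_apply]; simp

theorem apply_mul_mul (h : IsAlternativeRing R) (hv : Annihilates v d) (x y : R) :
    d x * (v * y) = -associator v y (d x) := by
  rw [← h.rotate (d x), associator_apply, hv.apply_mul]; simp

theorem mul_mul_apply_right (h : IsAlternativeRing R) (hd : IsLeibniz d) (hv : Annihilates v d)
    (x y : R) : v * (y * d x) = -associator v x (d y) := by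
  have e := hv.mul_apply (y * x)
  rw [hd, mul_add, h.mul_apply_mul hv] at e
  exact eq_neg_of_add_eq_zero_right e

theorem apply_mul_mul_left (h : IsAlternativeRing R) (hd : IsLeibniz d) (hv : Annihilates v d)
    (x y : R) : d x * y * v = -associator v x (d y) := by
  have e := hv.apply_mul (x * y)
  rw [hd, add_mul, h.mul_apply_mul' hv] at e
  exact eq_neg_of_add_eq_zero_left e

theorem mul_mul_apply (h : IsAlternativeRing R) (hd : IsLeibniz d) (hv : Annihilates v d)
    (x y : R) : v * y * d x = associator v y (d x) - associator v x (d y) := by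
  have e := h.mul_mul_apply_right hd hv x y
  simp only [associator] at *
  linear_combination (norm := abel) e

theorem apply_mul_mul' (h : IsAlternativeRing R) (hd : IsLeibniz d) (hv : Annihilates v d)
    (x y : R) : d x * (y * v) = associator v y (d x) - associator v x (d y) := by
  have e := h.apply_mul_mul_left hd hv x y
  have e' := h.rotate (d x) y v
  have e'' := h.swap_left v y (d x)
  rw [associator_apply (d x)] at e'
  linear_combination (norm := abel) e - e' - e''

theorem annihilates_mul_right (h : IsAlternativeRing R) (hd : IsLeibniz d)
    (hv : StronglyAnnihilates v d) (y : R) : Annihilates (v * y) d where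
  mul_apply x := by simp [h.mul_mul_apply hd hv.1, hv.associator_apply]
  apply_mul x := by simp [h.apply_mul_mul hv.1, hv.associator_apply]

theorem annihilates_mul_left (h : IsAlternativeRing R) (hd : IsLeibniz d)
    (hv : StronglyAnnihilates v d) (y : R) : Annihilates (y * v) d where
  mul_apply x := by simp [h.mul_mul_apply' hv.1, hv.associator_apply]
  apply_mul x := by simp [h.apply_mul_mul' hd hv.1, hv.associator_apply]

theorem associator_mul_swap (h : IsAlternativeRing R) (hd : IsLeibniz d)
    (hv : StronglyAnnihilates v d) (s t x : R) :
    associator (v * s) t (d x) = -associator (v * t) s (d x) := by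
  have hr := h.annihilates_mul_right hd hv
  -- `d x * (v, s, t)` is skew-symmetric in `s` and `t`.
  have e₁ := h.apply_mul_mul (hr s) x t
  have e₂ := (hr (s * t)).apply_mul x
  have e₃ := h.apply_mul_mul (hr t) x s
  have e₄ := (hr (t * s)).apply_mul x
  have e₅ := congrArg (d x * ·) (h.swap_right v s t)
  simp only [associator_apply v, mul_sub, mul_neg] at *
  linear_combination (norm := abel) e₁ + e₃ - e₅ - e₂ - e₄

theorem associator_mul_left_apply (h : IsAlternativeRing R) (hd : IsLeibniz d)
    (hv : StronglyAnnihilates v d) (s t x : R) :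
    associator (s * v) t (d x) = associator (v * t) x (d s) := by
  have hr := h.annihilates_mul_right hd hv
  have hl := h.annihilates_mul_left hd hv
  -- Expand `d x * (v, s, t) = - d x * (s, v, t)`.
  have e₁ := h.apply_mul_mul (hl s) x t
  have e₂ := h.apply_mul_mul' hd (hr t) x s
  have e₃ := h.apply_mul_mul (hr s) x t
  have e₄ := (hr (s * t)).apply_mul x
  have e₅ := congrArg (d x * ·) (h.swap_left v s t)
  have e₆ := h.associator_mul_swap hd hv s t x
  simp only [associator_apply v, associator_apply s v, mul_sub, mul_neg] at *
  linear_combination (norm := abel) e₁ - e₂ + e₃ - e₄ - e₅ - e₆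

theorem associator_mul_right_apply (h : IsAlternativeRing R) (hd : IsLeibniz d)
    (hv : StronglyAnnihilates v d) (s t x : R) :
    associator (v * s) t (d x) = -(2 • associator (v * t) x (d s)) := by
  have hr := h.annihilates_mul_right hd hv
  have hl := h.annihilates_mul_left hd hv
  -- Expand `d x * (v, s, t) = - d x * (t, s, v)`.
  have e₁ := h.apply_mul_mul' hd (hl s) x t
  have e₂ := (hl (t * s)).apply_mul x
  have e₃ := h.apply_mul_mul (hr s) x t
  have e₄ := (hr (s * t)).apply_mul x
  have e₅ := congrArg (d x * ·) ((h.swap_right v s t).trans (congrArg _ (h.rotate v t s)))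
  have e₆ := h.associator_mul_left_apply hd hv s t x
  have e₇ := h.associator_mul_left_apply hd hv s x t
  have e₈ := h.associator_mul_swap hd hv x t s
  simp only [associator_apply v s, associator_apply t s, mul_sub, mul_neg] at *
  linear_combination (norm := abel) e₂ + e₃ - e₄ - e₅ - e₁ - e₆ + e₇ + e₈

/-- The three cyclic shifts of `(vs, t, d x)` differ by factors `-2`, so `1 - (-2)³ = 9` kills it. -/
theorem associator_mul_eq_zero (h : IsAlternativeRing R) (h3 : IsTorsionFreeBy 3 R)
    (hd : IsLeibniz d) (hv : StronglyAnnihilates v d) (s t x : R) :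
    associator (v * s) t (d x) = 0 := by
  have e₁ := h.associator_mul_right_apply hd hv s t x
  have e₂ := h.associator_mul_right_apply hd hv t x s
  have e₃ := h.associator_mul_right_apply hd hv x s t
  refine h3 _ (h3 _ ?_)
  linear_combination (norm := abel) e₁ - 2 • e₂ + 4 • e₃

theorem stronglyAnnihilates_mul_right (h : IsAlternativeRing R) (h3 : IsTorsionFreeBy 3 R)
    (hd : IsLeibniz d) (hv : StronglyAnnihilates v d) (s : R) : StronglyAnnihilates (v * s) d :=
  ⟨h.annihilates_mul_right hd hv s, h.associator_mul_eq_zero h3 hd hv s⟩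

theorem stronglyAnnihilates_mul_left (h : IsAlternativeRing R) (h3 : IsTorsionFreeBy 3 R)
    (hd : IsLeibniz d) (hv : StronglyAnnihilates v d) (s : R) : StronglyAnnihilates (s * v) d :=
  ⟨h.annihilates_mul_left hd hv s, fun t x => by
    rw [h.associator_mul_left_apply hd hv, h.associator_mul_eq_zero h3 hd hv]⟩

end Leibniz

/-! ### Derivations of prime rings -/

/-- If an ideal of a prime alternative ring is annihilated by `w` from both sides, then it is zero
or `w = 0`, because the annihilator of an ideal is an ideal. -/
theorem eq_zero_of_annihilates_ideal (h : IsAlternativeRing R) (hp : IsPrimeNonAssocRing R)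
    {T : TwoSidedIdeal R} {v w : R} (hv : v ∈ T) (hw : ∀ t ∈ T, t * w = 0 ∧ w * t = 0) :
    v = 0 ∨ w = 0 := by
  let S : TwoSidedIdeal R := .mk' {w | ∀ t ∈ T, t * w = 0 ∧ w * t = 0}
    (by simp)
    (fun {x y} hx hy t ht => by
      simp [mul_add, add_mul, hx t ht, hy t ht])
    (fun {x} hx t ht => by simp [hx t ht])
    (fun {x y} hy t ht => by
      have e : associator y t x = 0 := by
        simp [associator, hy t ht, hy _ (T.mul_mem_right _ x ht)]
      have e₁ := (h.rotate y t x).symm.trans e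
      have e₂ := (h.rotate t x y).symm.trans e₁
      simp only [associator, hy t ht, hy _ (T.mul_mem_right _ x ht), mul_zero, zero_sub,
        sub_zero, neg_eq_zero] at e₁ e₂
      exact ⟨e₁, e₂⟩)
    (fun {x y} hx t ht => by
      have e : associator y t x = 0 := by
        simp [associator, hx t ht, hx _ (T.mul_mem_left y _ ht)]
      have e₁ := (h.rotate y t x).symm.trans e
      have e₂ := (h.rotate t x y).symm.trans e₁
      simp only [associator, hx t ht, hx _ (T.mul_mem_left y _ ht), zero_mul, zero_sub,
        sub_zero, neg_eq_zero] at e₁ e₂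
      exact ⟨e₁, e₂⟩)
  by_contra! hne
  obtain ⟨t, ht, s, hs, hts⟩ := hp T S
    (fun hT => hne.1 (by simpa [hT] using hv))
    (fun hS => hne.2 (by
      have : w ∈ S := (TwoSidedIdeal.mem_mk' ..).2 hw
      simpa [hS] using this))
  exact hts (((TwoSidedIdeal.mem_mk' ..).1 hs) t ht).1

/-- In a prime alternative ring, a derivation that is strongly annihilated by a nonzero element
vanishes, because the elements that strongly annihilate it form an ideal. -/
theorem eq_zero_of_stronglyAnnihilates (h : IsAlternativeRing R) (h3 : IsTorsionFreeBy 3 R)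
    (hp : IsPrimeNonAssocRing R) {d : R → R} {v : R} (hd : IsLeibniz d)
    (hv : StronglyAnnihilates v d) : v = 0 ∨ ∀ x, d x = 0 := by
  let T : TwoSidedIdeal R := .mk' {v | StronglyAnnihilates v d}
    ⟨⟨by simp, by simp⟩, by simp [associator]⟩
    (fun {x y} hx hy => ⟨⟨fun z => by simp [add_mul, hx.mul_apply, hy.mul_apply],
      fun z => by simp [mul_add, hx.apply_mul, hy.apply_mul]⟩, fun y z => by
        have e₁ := hx.associator_apply y z
        have e₂ := hy.associator_apply y z
        simp only [associator, add_mul] at *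
        linear_combination (norm := abel) e₁ + e₂⟩)
    (fun {x} hx => ⟨⟨fun z => by simp [hx.mul_apply], fun z => by simp [hx.apply_mul]⟩,
      fun y z => by
        have e := hx.associator_apply y z
        simp only [associator, neg_mul] at *
        linear_combination (norm := abel) -e⟩)
    (fun {x y} hy => h.stronglyAnnihilates_mul_left h3 hd hy x)
    (fun {x y} hx => h.stronglyAnnihilates_mul_right h3 hd hx y)
  refine or_iff_not_imp_left.2 fun hv0 x => ?_
  refine (h.eq_zero_of_annihilates_ideal hp (T := T) ((TwoSidedIdeal.mem_mk' ..).2 hv)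
    fun t ht => ?_).resolve_left hv0
  have ht' : StronglyAnnihilates t d :=
    (TwoSidedIdeal.mem_mk' {v | StronglyAnnihilates v d} _ _ _ _ _ t).1 ht
  exact ⟨ht'.mul_apply x, ht'.apply_mul x⟩

/-! ### The derivations `(a, ·, c)` for `ac = ca = 0` -/

theorem isLeibniz_associator (h : IsAlternativeRing R) {a c : R} (hac : a * c = 0)
    (hca : c * a = 0) : IsLeibniz fun x => associator a x c := by
  intro x y
  have k := h.kleinfeld_eq y x c a
  have s : associator (y * x - x * y) c a = associator (y * x) c a - associator (x * y) c a := by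
    simp only [associator, sub_mul]; abel
  have z : associator (c * a - a * c) y x = 0 := by simp [hac, hca, associator]
  rw [s, z] at k
  simp only [kleinfeld, ← h.rotate a] at k
  linear_combination (norm := abel) k

theorem mul_associator (h : IsAlternativeRing R) (a x w : R) :
    a * associator a x w = associator a x (w * a) := by
  rw [h.swap_left a x (w * a), h.associator_mul_left, h.swap_left a x w, mul_neg]

theorem associator_mul (h : IsAlternativeRing R) (a x w : R) :
    associator a x w * a = associator a x (a * w) := by
  rw [h.swap_left a x (a * w), h.associator_mul_right, h.swap_left a x w, neg_mul]

theorem associator_mul_middle (h : IsAlternativeRing R) (a x w : R) :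
    associator a (x * a) w = associator a x (w * a) := by
  rw [← h.rotate w, h.associator_mul_left, h.rotate w, h.mul_associator]

section Commuting

variable {a c : R}

theorem annihilates_associator (h : IsAlternativeRing R) (hac : a * c = 0) (hca : c * a = 0) :
    Annihilates a fun x => associator a x c where
  mul_apply x := by rw [h.mul_associator, hca]; simp [associator]
  apply_mul x := by rw [h.associator_mul, hac]; simp [associator]

theorem mul_mul_eq_associator (h : IsAlternativeRing R) (hac : a * c = 0) (x : R) :
    a * (c * x) = associator a x c := by
  rw [h.swap_right, associator_apply, hac]; simp

theorem mul_mul_eq_associator' (h : IsAlternativeRing R) (hca : c * a = 0) (x : R) :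
    x * c * a = associator a x c := by
  rw [h.rotate, associator_apply, hca]; simp

theorem mul_mul_eq_neg_associator (h : IsAlternativeRing R) (hac : a * c = 0) (x : R) :
    x * a * c = -associator a x c := by
  rw [h.swap_left, associator_apply, hac]; simp

/-- The relation between the maps `y ↦ (ay)c`, `y ↦ (cy)a` and the derivation `y ↦ (a, y, c)` that
results from expanding both sides of `a (xa, c, y) = -a (xa, y, c)` with the left Moufang
identity. -/
theorem associator_relation (h : IsAlternativeRing R) (hac : a * c = 0) (hca : c * a = 0)
    (x y : R) :
    a * (x * a * y) * c + associator a x (c * y * a) - a * (x * (a * y * c)) +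
      2 • associator a x (associator a y c) - associator a y (associator a x c) = 0 := by
  have hd := h.isLeibniz_associator hac hca
  have hv := h.annihilates_associator hac hca
  have e₁ := h.left_moufang a x (c * y)
  have e₂ := h.associator_mul_middle a x (c * y)
  have e₃ := congrArg (a * ·) (h.swap_right (x * a) c y)
  have e₄ := h.associator_mul_middle a x (y * c)
  have e₅ := h.left_moufang a x (y * c)
  have e₆ : associator a (x * a * y) c = -associator a x (associator a y c) := by
    have l₁ := hd (x * a) y
    have l₂ := hd x a
    have l₃ := hv.apply_mul x
    beta_reduce at l₁ l₂ l₃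
    rw [l₁, l₂, l₃, h.left_alternative, mul_zero, add_zero, zero_mul, zero_add,
      h.mul_mul_apply' hv]
  have e₇ : a * (y * c) = a * y * c - associator a y c := by rw [associator_apply]; abel
  have e₈ := h.mul_apply_mul hv x y
  rw [h.mul_mul_eq_associator hac] at e₁
  rw [h.mul_mul_eq_associator' hca] at e₄
  rw [e₇, mul_sub, mul_sub] at e₅
  rw [associator_apply a (x * a)] at e₂ e₄
  rw [associator_apply a (x * a * y)] at e₆
  simp only [associator_apply (x * a), h.mul_mul_eq_neg_associator hac, mul_sub, neg_mul,
    mul_neg] at e₃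
  linear_combination (norm := abel) e₁ - e₂ + e₃ - e₄ + e₅ + e₆ + e₈

end Commuting

/-! ### Orthogonal elements -/

/-- A strong form of orthogonality: all products of `a` and `b`, and all products of `a`, `b` and
a third element in which each of `a` and `b` occurs once, vanish. The five conditions suffice for
this, see `IsAlternativeRing.Orthogonal.mul_mul` and its companions. -/
structure Orthogonal (a b : R) : Prop where
  mul_eq_zero : a * b = 0
  mul_eq_zero' : b * a = 0
  associator_eq_zero : ∀ x, associator a x b = 0
  mul_mul_eq_zero : ∀ x, a * x * b = 0
  mul_mul_eq_zero' : ∀ x, b * x * a = 0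

theorem leibniz_apply_mul_mul (h : IsAlternativeRing R) {d : R → R} {v : R} (hd : IsLeibniz d)
    (hv : Annihilates v d) (hdv : d v = 0) (x y : R) :
    d (x * v * y) = -associator v x (d y) := by
  rw [hd, hd x v, hv.apply_mul, hdv, mul_zero, add_zero, zero_mul, zero_add, h.mul_mul_apply' hv]

namespace Orthogonal

variable {a b : R}

theorem associator_left (h : IsAlternativeRing R) (o : Orthogonal a b) (x : R) :
    associator b a x = 0 := by
  rw [h.rotate, o.associator_eq_zero]

theorem associator_right (h : IsAlternativeRing R) (o : Orthogonal a b) (x : R) :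
    associator x b a = 0 := by
  rw [h.rotate, o.associator_left h]

theorem symm (h : IsAlternativeRing R) (o : Orthogonal a b) : Orthogonal b a where
  mul_eq_zero := o.mul_eq_zero'
  mul_eq_zero' := o.mul_eq_zero
  associator_eq_zero x := by rw [h.swap_right, o.associator_left h, neg_zero]
  mul_mul_eq_zero := o.mul_mul_eq_zero'
  mul_mul_eq_zero' := o.mul_mul_eq_zero

theorem mul_mul (o : Orthogonal a b) (x : R) : a * (x * b) = 0 := by
  simpa [associator, o.mul_mul_eq_zero] using o.associator_eq_zero x

theorem mul_mul' (h : IsAlternativeRing R) (o : Orthogonal a b) (x : R) : a * (b * x) = 0 := by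
  rw [h.mul_mul_eq_associator o.mul_eq_zero, o.associator_eq_zero]

theorem mul_mul_right (h : IsAlternativeRing R) (o : Orthogonal a b) (x : R) :
    x * b * a = 0 := by
  rw [h.mul_mul_eq_associator' o.mul_eq_zero', o.associator_eq_zero]

theorem associator_mul_left (h : IsAlternativeRing R) (o : Orthogonal a b) (y z : R) :
    associator a y (z * b) = b * associator z a y := by
  have k : kleinfeld z b a y = 0 := by
    rw [h.kleinfeld_rotate, kleinfeld]
    simp [o.associator_right h]
  rw [kleinfeld, o.associator_left h, zero_mul, sub_zero] at k
  rw [← h.rotate, sub_eq_zero.1 k]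

theorem associator_mul_left_swap (h : IsAlternativeRing R) (o : Orthogonal a b) (y z : R) :
    associator a y (z * b) = -associator a z (y * b) := by
  rw [o.associator_mul_left h, o.associator_mul_left h, h.rotate z, h.swap_left a, mul_neg]

theorem mul_mul_mul (h : IsAlternativeRing R) (o : Orthogonal a b) (y z : R) :
    a * y * (z * b) = associator a y (z * b) - associator b y (z * a) := by
  have e₁ := h.middle_moufang_add a y z b
  have e₂ := (o.associator_mul_left h y z).trans
    (congrArg (b * ·) ((h.rotate z a y).trans (h.rotate a y z)))
  rw [o.mul_mul_eq_zero, o.mul_mul_eq_zero'] at e₁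
  simp only [associator_apply y z, associator_apply b y, mul_sub, (o.symm h).mul_mul] at *
  linear_combination (norm := abel) e₁ - e₂

theorem mul_mul_mul' (h : IsAlternativeRing R) (o : Orthogonal a b) (y z : R) :
    z * b * y * a = associator b y (z * a) - associator a y (z * b) := by
  have e₁ : associator (z * b) y a = -associator a y (z * b) := by
    rw [h.rotate, h.rotate, h.swap_right]
  have e₂ : z * b * (y * a) = associator z b (y * a) := by
    rw [associator_apply, (o.symm h).mul_mul, mul_zero, sub_zero]
  have e₃ : associator z b (y * a) = associator b y (z * a) := by
    rw [h.rotate, h.swap_right, ← (o.symm h).associator_mul_left_swap h]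
  rw [associator_apply] at e₁
  linear_combination (norm := abel) e₁ + e₂ + e₃

theorem isLeibniz (h : IsAlternativeRing R) (o : Orthogonal a b) (z : R) :
    IsLeibniz fun y => associator a y (z * b) :=
  h.isLeibniz_associator (o.mul_mul z) (o.mul_mul_right h z)

/-- The derivation `y ↦ (b, y, za) = -(za)(by)` vanishes at `xa`, `ax` and `a`, hence is annihilated
by `a`. -/
theorem annihilates (h : IsAlternativeRing R) (o : Orthogonal a b) (z : R) :
    Annihilates a fun y => associator b y (z * a) := by
  have hd := (o.symm h).isLeibniz h z
  have key (y : R) : associator b y (z * a) = -(z * a * (b * y)) := by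
    rw [← h.rotate (z * a), associator_apply, (o.symm h).mul_mul_right h, zero_mul, zero_sub]
  have e := key a
  refine ⟨fun x => ?_, fun x => ?_⟩
  · have l := hd a x
    have e' := key (a * x)
    simp_all [o.mul_eq_zero', (o.symm h).mul_mul' h]
  · have l := hd x a
    have e' := key (x * a)
    simp_all [o.mul_eq_zero', (o.symm h).mul_mul]

theorem associator_apply_eq_zero (h : IsAlternativeRing R) (h3 : IsTorsionFreeBy 3 R)
    (o : Orthogonal a b) (x y z : R) : associator a x (associator b y (z * a)) = 0 := by
  have key (x y : R) : 2 • associator a x (associator b y (z * a)) =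
      associator a y (associator b x (z * a)) := by
    have e₁ := h.associator_relation (o.mul_mul z) (o.mul_mul_right h z) x y
    have hd := o.isLeibniz h z
    have hv := h.annihilates_associator (o.mul_mul z) (o.mul_mul_right h z)
    have hd' := (o.symm h).isLeibniz h z
    have hv' := o.annihilates h z
    have l₁ := h.leibniz_apply_mul_mul hd hv (h.left_alternative _ _) x y
    have l₂ := h.leibniz_apply_mul_mul hd' hv' (o.associator_left h _) x y
    have l₃ := h.mul_mul_apply_right hd hv y x
    have l₄ := h.mul_mul_apply_right hd' hv' y x
    have l₅ : associator a x (associator b y (z * a) - associator a y (z * b)) =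
        associator a x (associator b y (z * a)) - associator a x (associator a y (z * b)) := by
      simp only [associator_apply a x, mul_sub]; abel
    rw [o.mul_mul_mul h, o.mul_mul_mul h, o.mul_mul_mul' h, l₅, mul_sub, mul_sub] at e₁
    linear_combination (norm := abel) e₁ - l₁ + l₂ + l₃ - l₄
  have e₁ := key x y
  have e₂ := key y x
  refine h3 _ ?_
  linear_combination (norm := abel) 2 • e₁ + e₂

end Orthogonal

section Prime

variable {a b : R}

theorem Orthogonal.associator_eq_zero_of_ne_zero (h : IsAlternativeRing R)
    (h3 : IsTorsionFreeBy 3 R) (hp : IsPrimeNonAssocRing R) (o : Orthogonal a b) (ha : a ≠ 0)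
    (x z : R) : associator b x (z * a) = 0 :=
  (h.eq_zero_of_stronglyAnnihilates h3 hp ((o.symm h).isLeibniz h z)
    ⟨o.annihilates h z, fun y x => o.associator_apply_eq_zero h h3 y x z⟩).resolve_left ha x

/-- If the associators `(b, x, za)` and `(a, x, zb)` vanish, orthogonality to `a` passes from `b`
to its left multiples. -/
theorem Orthogonal.mul_left (h : IsAlternativeRing R) (o : Orthogonal a b)
    (hab : ∀ x z, associator a x (z * b) = 0) (hba : ∀ x z, associator b x (z * a) = 0) (z : R) :
    Orthogonal a (z * b) where
  mul_eq_zero := o.mul_mul z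
  mul_eq_zero' := o.mul_mul_right h z
  associator_eq_zero x := hab x z
  mul_mul_eq_zero x := by rw [o.mul_mul_mul h, hab, hba, sub_zero]
  mul_mul_eq_zero' x := by rw [o.mul_mul_mul' h, hab, hba, sub_zero]

theorem Orthogonal.associator_mul_right (h : IsAlternativeRing R) (o : Orthogonal a b) (x z : R) :
    associator a x (b * z) = associator b z (x * a) := by
  have e := h.mul_mul_eq_neg_associator (o.mul_mul' h z) x
  rw [← h.rotate (x * a) b z, associator_apply (x * a), (o.symm h).mul_mul_right h, zero_mul,
    zero_sub, e, neg_neg]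

theorem Orthogonal.mul_right (h : IsAlternativeRing R) (o : Orthogonal a b)
    (hab : ∀ x z, associator a x (z * b) = 0) (hba : ∀ x z, associator b x (z * a) = 0) (z : R) :
    Orthogonal a (b * z) where
  mul_eq_zero := o.mul_mul' h z
  mul_eq_zero' := o.mul_mul_eq_zero' z
  associator_eq_zero x := by rw [o.associator_mul_right h, hba]
  mul_mul_eq_zero x := by
    have e := (o.symm h).associator_mul_right h z x
    rw [hab, ← h.rotate (a * x), associator_apply, o.mul_mul_eq_zero] at e
    simpa using e
  mul_mul_eq_zero' x := by
    have e₁ : associator (b * z) x a = 0 := by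
      rw [h.rotate, h.rotate, h.swap_right, o.associator_mul_right h, hba, neg_zero]
    have e₂ := hba z x
    have e₃ : b * associator z x a = 0 := by
      rw [h.swap_right, mul_neg, ← o.associator_mul_left h, hab, neg_zero]
    have e₄ := (o.symm h).mul_mul (z * x)
    simp only [associator_apply, mul_sub] at e₁ e₂ e₃
    linear_combination (norm := abel) e₁ + e₂ - e₃ + e₄

/-- In a prime alternative ring without 3-torsion, orthogonal elements are trivially so: the
elements orthogonal to a given `a ≠ 0` form an ideal that is annihilated by `a`. -/
theorem Orthogonal.eq_zero_or_eq_zero (h : IsAlternativeRing R) (h3 : IsTorsionFreeBy 3 R)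
    (hp : IsPrimeNonAssocRing R) (o : Orthogonal a b) : a = 0 ∨ b = 0 := by
  refine or_iff_not_imp_left.2 fun ha => ?_
  have o₀ : Orthogonal a 0 := ⟨by simp, by simp, by simp [associator], by simp, by simp⟩
  have hba {c : R} (oc : Orthogonal a c) (x z : R) : associator c x (z * a) = 0 :=
    oc.associator_eq_zero_of_ne_zero h h3 hp ha x z
  have hab {c : R} (oc : Orthogonal a c) (hc : c ≠ 0) (x z : R) : associator a x (z * c) = 0 :=
    (oc.symm h).associator_eq_zero_of_ne_zero h h3 hp hc x z
  let T : TwoSidedIdeal R := .mk' {c | Orthogonal a c} o₀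
    (fun {x y} hx hy => ⟨by simp [mul_add, hx.mul_eq_zero, hy.mul_eq_zero],
      by simp [add_mul, hx.mul_eq_zero', hy.mul_eq_zero'],
      fun z => by
        have e₁ := hx.associator_eq_zero z
        have e₂ := hy.associator_eq_zero z
        simp only [associator, mul_add] at *
        linear_combination (norm := abel) e₁ + e₂,
      fun z => by simp [mul_add, hx.mul_mul_eq_zero, hy.mul_mul_eq_zero],
      fun z => by simp [add_mul, hx.mul_mul_eq_zero', hy.mul_mul_eq_zero']⟩)
    (fun {x} hx => ⟨by simp [hx.mul_eq_zero], by simp [hx.mul_eq_zero'],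
      fun z => by
        have e := hx.associator_eq_zero z
        simp only [associator, mul_neg] at *
        linear_combination (norm := abel) -e,
      fun z => by simp [hx.mul_mul_eq_zero], fun z => by simp [hx.mul_mul_eq_zero']⟩)
    (fun {x y} hy => by
      rcases eq_or_ne y 0 with rfl | h0
      · simpa using o₀
      · exact hy.mul_left h (hab hy h0) (hba hy) x)
    (fun {x y} hx => by
      rcases eq_or_ne x 0 with rfl | h0
      · simpa using o₀
      · exact hx.mul_right h (hab hx h0) (hba hx) y)
  refine (h.eq_zero_of_annihilates_ideal hp (T := T) ((TwoSidedIdeal.mem_mk' ..).2 o)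
    fun t ht => ?_).resolve_right ha
  have ht' : Orthogonal a t :=
    (TwoSidedIdeal.mem_mk' {c | Orthogonal a c} _ _ _ _ _ t).1 ht
  exact ⟨ht'.mul_eq_zero', ht'.mul_eq_zero⟩

end Prime

/-! ### Nondegeneracy and the condition `(aR)b = 0` -/

/-- A prime alternative ring without 3-torsion is nondegenerate. -/
theorem eq_zero_of_mul_mul_self (h : IsAlternativeRing R) (h3 : IsTorsionFreeBy 3 R)
    (hp : IsPrimeNonAssocRing R) {c : R} (hc : ∀ x, c * x * c = 0) : c = 0 := by
  have ho {d : R} (hd : ∀ x, d * x * d = 0) (hdd : d * d = 0) : d = 0 :=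
    (Orthogonal.eq_zero_or_eq_zero h h3 hp (a := d) (b := d)
      ⟨hdd, hdd, h.flexible d, hd, hd⟩).elim id id
  -- The square of `c` inherits the hypothesis and has square zero.
  refine ho hc (ho (fun x => ?_) ?_)
  · rw [h.mul_self_mul, h.middle_moufang, hc]
  · rw [h.middle_moufang, hc]

theorem mul_mul_mul_mul_self (h : IsAlternativeRing R) (u x z : R) :
    u * x * z * (u * x) = u * (x * z) * u * x := by
  have e := h.middle_moufang_add (u * x) z u x
  rw [← h.mul_self_mul, h.middle_moufang, h.middle_moufang, h.middle_moufang, h.mul_mul_self] at e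
  exact add_right_cancel e

section

variable {a b : R}

theorem mul_mul_eq_zero_swap (h : IsAlternativeRing R) (h3 : IsTorsionFreeBy 3 R)
    (hp : IsPrimeNonAssocRing R) (hab : ∀ x, a * x * b = 0) (y : R) : b * y * a = 0 := by
  -- By the Moufang identities, `t = (by)a` satisfies `tzt = 0` for all `z`.
  refine h.eq_zero_of_mul_mul_self h3 hp fun z => ?_
  have e₁ : b * y * (a * z * (b * y)) = 0 := by
    have e := h.middle_moufang_add' b y (a * z) (b * y)
    rw [hab, mul_zero, add_zero, h.middle_moufang y, hab, mul_zero, zero_mul, mul_zero, zero_add,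
      h.middle_moufang, ← h.mul_self_mul, ← h.middle_moufang, hab, mul_zero] at e
    exact e
  rw [h.mul_mul_mul_mul_self, h.flexible_mul, e₁, zero_mul]

theorem mul_eq_zero_of_mul_mul_eq_zero (h : IsAlternativeRing R) (h3 : IsTorsionFreeBy 3 R)
    (hp : IsPrimeNonAssocRing R) (hab : ∀ x, a * x * b = 0) : a * b = 0 :=
  h.eq_zero_of_mul_mul_self h3 hp fun z => by
    rw [h.mul_mul_mul_mul_self, h.flexible_mul, hab]

theorem associator_associator_eq_zero (h : IsAlternativeRing R) (h3 : IsTorsionFreeBy 3 R)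
    (hab : ∀ x, a * x * b = 0) (hba : ∀ x, b * x * a = 0) (hac : a * b = 0) (hca : b * a = 0)
    (x y : R) : associator a x (associator a y b) = 0 := by
  have key (x y : R) : 2 • associator a x (associator a y b) =
      associator a y (associator a x b) := by
    have e := h.associator_relation hac hca x y
    have e₀ : associator a x 0 = 0 := by simp [associator_apply]
    rw [hab, hba, hab, mul_zero, mul_zero, e₀] at e
    linear_combination (norm := abel) e
  have e₁ := key x y
  have e₂ := key y x
  refine h3 _ ?_
  linear_combination (norm := abel) 2 • e₁ + e₂

theorem eq_zero_or_eq_zero_of_mul_mul (h : IsAlternativeRing R) (h3 : IsTorsionFreeBy 3 R)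
    (hp : IsPrimeNonAssocRing R) (hab : ∀ x, a * x * b = 0) : a = 0 ∨ b = 0 := by
  have hba := h.mul_mul_eq_zero_swap h3 hp hab
  have hac := h.mul_eq_zero_of_mul_mul_eq_zero h3 hp hab
  have hca := h.mul_eq_zero_of_mul_mul_eq_zero h3 hp hba
  rcases h.eq_zero_of_stronglyAnnihilates h3 hp (h.isLeibniz_associator hac hca)
    ⟨h.annihilates_associator hac hca,
      fun y x => h.associator_associator_eq_zero h3 hab hba hac hca y x⟩ with ha | hd
  · exact .inl ha
  · exact Orthogonal.eq_zero_or_eq_zero h h3 hp ⟨hac, hca, hd, hab, hba⟩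

end

/-! ### Passage to the opposite ring -/

theorem mulOpposite (h : IsAlternativeRing R) : IsAlternativeRing Rᵐᵒᵖ where
  left_alternative x y := by
    have e := h.mul_mul_self x.unop y.unop
    simp [associator_apply, ← MulOpposite.unop_inj, e]
  right_alternative x y := by
    have e := h.mul_self_mul x.unop y.unop
    simp [associator_apply, ← MulOpposite.unop_inj, e]

end IsAlternativeRing

theorem IsPrimeNonAssocRing.mulOpposite {R : Type*} [NonUnitalNonAssocRing R]
    (hp : IsPrimeNonAssocRing R) : IsPrimeNonAssocRing Rᵐᵒᵖ := by
  intro A B hA hB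
  have ne {I : TwoSidedIdeal Rᵐᵒᵖ} (hI : I ≠ ⊥) : I.unop ≠ ⊥ := fun e => hI <| by
    refine le_bot_iff.1 fun x hx => ?_
    have hx' : x.unop ∈ I.unop := TwoSidedIdeal.mem_unop_iff.2 hx
    rw [e] at hx'
    exact (TwoSidedIdeal.mem_bot _).2 (MulOpposite.unop_injective ((TwoSidedIdeal.mem_bot _).1 hx'))
  obtain ⟨b, hb, a, ha, hba⟩ := hp B.unop A.unop (ne hB) (ne hA)
  exact ⟨.op a, TwoSidedIdeal.mem_unop_iff.1 ha, .op b, TwoSidedIdeal.mem_unop_iff.1 hb,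
    fun e => hba (MulOpposite.op_injective (by simpa using e))⟩

theorem TwoSidedIdeal.exists_mem_ne_zero_of_ne_bot {R : Type*} [NonUnitalNonAssocRing R]
    {I : TwoSidedIdeal R} (hI : I ≠ ⊥) : ∃ x ∈ I, x ≠ 0 := by
  by_contra! H
  exact hI (le_bot_iff.1 fun x hx => (TwoSidedIdeal.mem_bot _).2 (H x hx))

theorem theorem1 {R : Type*} [NonUnitalNonAssocRing R] (hR : IsAlternativeRing R)
    (h3 : IsTorsionFreeBy 3 R) :
    (IsPrimeNonAssocRing R ↔
      ∀ a b : R, (∀ x : R, (a * x) * b = 0) → a = 0 ∨ b = 0) ∧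
    (IsPrimeNonAssocRing R ↔
      ∀ a b : R, (∀ x : R, a * (x * b) = 0) → a = 0 ∨ b = 0) := by
  refine ⟨⟨fun hp a b hab => hR.eq_zero_or_eq_zero_of_mul_mul h3 hp hab, fun H A B hA hB => ?_⟩,
    ⟨fun hp a b hab => ?_, fun H A B hA hB => ?_⟩⟩
  · obtain ⟨a, ha, ha0⟩ := TwoSidedIdeal.exists_mem_ne_zero_of_ne_bot hA
    obtain ⟨b, hb, hb0⟩ := TwoSidedIdeal.exists_mem_ne_zero_of_ne_bot hB
    by_contra! hAB
    exact (H a b fun x => hAB _ (A.mul_mem_right _ _ ha) _ hb).elim ha0 hb0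
  · have h3' : IsTorsionFreeBy 3 Rᵐᵒᵖ := fun x hx =>
      MulOpposite.unop_injective (h3 _ (by rw [← MulOpposite.unop_smul, hx, MulOpposite.unop_zero]))
    have e := hR.mulOpposite.eq_zero_or_eq_zero_of_mul_mul h3' hp.mulOpposite
      (a := .op b) (b := .op a) fun x => MulOpposite.unop_injective (by simpa using hab x.unop)
    simpa [or_comm] using e
  · obtain ⟨a, ha, ha0⟩ := TwoSidedIdeal.exists_mem_ne_zero_of_ne_bot hA
    obtain ⟨b, hb, hb0⟩ := TwoSidedIdeal.exists_mem_ne_zero_of_ne_bot hB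
    by_contra! hAB
    exact (H a b fun x => hAB _ ha _ (B.mul_mem_left _ _ hb)).elim ha0 hb0
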